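/- For integers $N\ge d\ge 1$, let $\mathcal{F}^{\mathbb{C}}_{N,d}$ be the set of finite unit norm tight frames of $N$ vectors in $\mathbb{C}^d$, that is, of all $N$-tuples $(f_1,\dots,f_N)$ of vectors in $\mathbb{C}^d$ such that $\|f_n\|=1$ for every $n$ and such that there is a constant $A>0$ with $$\sum_{n=1}^N|\langle x,f_n\rangle|^2=A\|x\|^2\qquad\text{for all }x\in\mathbb{C}^d,$$ where $\langle\cdot,\cdot\rangle$ is the standard inner product and $\|\cdot\|$ its norm. Give $\mathcal{F}^{\mathbb{C}}_{N,d}$ the subspace topology from $(\mathbb{C}^d)^N\cong\mathbb{C}^{d\times N}$. **Theorem.** For all integers $N\ge d\ge 1$, the space $\mathcal{F}^{\mathbb{C}}_{N,d}$ is (nonempty and) path-connected. -/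

import Mathlib

/-- A finite family `f` of vectors is a frame with lower bound `A` and upper bound `B`: both are
strictly positive and `A ‖x‖² ≤ ∑ n, |⟪x, f n⟫|² ≤ B ‖x‖²` for every `x`. -/
def IsFrameWithBounds (𝕜 : Type*) {H ι : Type*} [RCLike 𝕜] [NormedAddCommGroup H]
    [InnerProductSpace 𝕜 H] [Fintype ι] (A B : ℝ) (f : ι → H) : Prop :=
  0 < A ∧ 0 < B ∧ ∀ x : H,
    A * ‖x‖ ^ 2 ≤ ∑ n, ‖inner 𝕜 x (f n)‖ ^ 2 ∧ ∑ n, ‖inner 𝕜 x (f n)‖ ^ 2 ≤ B * ‖x‖ ^ 2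

/-- A finite family is a tight frame if it is a frame whose two bounds can be taken equal. -/
def IsTightFrame (𝕜 : Type*) {H ι : Type*} [RCLike 𝕜] [NormedAddCommGroup H]
    [InnerProductSpace 𝕜 H] [Fintype ι] (f : ι → H) : Prop :=
  ∃ A : ℝ, IsFrameWithBounds 𝕜 A A f

/-- The space of finite unit norm tight frames of `N` vectors in `𝕜 ^ d`, as a subset of the
space of all `N`-tuples of vectors (with the product topology, that is, the usual topology of
the space of `d × N` matrices). -/
def FUNTF (𝕜 : Type*) [RCLike 𝕜] (N d : ℕ) : Set (Fin N → EuclideanSpace 𝕜 (Fin d)) :=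
  {f | (∀ n, ‖f n‖ = 1) ∧ IsTightFrame 𝕜 f}

/-!
Write a frame as the matrix `G` of its columns; finite unit norm tight frames are the `G` with
`G Gᴴ = (N / d) • 1` whose Gram matrix has ones on the diagonal. The complement of the full spark
frames is a proper algebraic set in a complex vector space, hence on a complex line through
a full spark frame only finitely many points are not full spark, and these do not disconnect the
line (`isPathConnected_setOf_isFullSpark`). It remains to push such a path into the tight frames.

This is done by rescaling the columns `gⱼ` to `exp (xⱼ / 2) gⱼ` and then normalizing the frame
operator `S` to a scalar by applying a multiple of `S ^ (-1/2)`. By Cauchy-Binet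
(`factorial_mul_det_mul`) the determinant of the frame operator of the rescaled frame is an
exponential sum in `x` whose coefficients are the squared maximal minors of `G`, and the resulting
vectors all have norm one exactly if `x` is a critical point of this sum, restricted to vectors `x`
with sum zero (`IsStable.isBalanced_scaleColumns`, `IsBalanced.normalizeFrame_mem`). Such a sum is
strictly convex and coercive as soon as `0` is interior to the convex hull of its frequencies; the
minimizer then exists, is unique, and depends continuously on the coefficients
(`exists_continuousOn_minimizer`). So on the set of stable frames there is a continuous map to the
tight frames that fixes the tight ones (`exists_retraction_of_isStable`).

Full spark frames are stable when `d < N` (`IsFullSpark.isStable`). A unit norm tight frame is stable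
if it does not split into two mutually orthogonal families (`IsOrthoIndecomposable.isStable`): were
all bases of the same total weight for some nonconstant weights on the vectors, an exchange argument
would produce a self-adjoint operator having the frame vectors as eigenvectors with these weights as
eigenvalues. Finally, a frame that does split can be joined to one that does not: rotating two
orthogonal vectors in the plane they span keeps the frame operator, and merges the two orthogonal
pieces they come from (`exists_joinedIn_isOrthoIndecomposable`). When `N = d` no rescaling is needed,
and the normalization alone maps the invertible matrices to the tight frames.
-/

open Filter Topology Matrix

/-! ### Minimizers of exponential sums -/

section ExpSum

variable {ι E : Type*} [Fintype ι] [NormedAddCommGroup E] [NormedSpace ℝ E]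

/-- The exponential sum with frequencies `L i` and coefficients `c i`. -/
noncomputable def expSum (L : ι → E →L[ℝ] ℝ) (c : ι → ℝ) (x : E) : ℝ :=
  ∑ i, c i * Real.exp (L i x)

/-- The coefficients `c` are nonnegative, the frequencies in the support of `c` separate points, and
some combination of them with strictly positive coefficients vanishes. For `E` of positive finite
dimension this says that `0` lies in the interior of their convex hull in the dual space. -/
def PositivelySpans (L : ι → E →L[ℝ] ℝ) (c : ι → ℝ) : Prop :=
  (∀ i, 0 ≤ c i) ∧ (∀ x, (∀ i, c i ≠ 0 → L i x = 0) → x = 0) ∧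
    ∃ μ : ι → ℝ, (∀ i, 0 ≤ μ i) ∧ (∀ i, μ i = 0 ↔ c i = 0) ∧ ∀ x, ∑ i, μ i * L i x = 0

theorem continuous_expSum (L : ι → E →L[ℝ] ℝ) :
    Continuous fun p : (ι → ℝ) × E => expSum L p.1 p.2 := by
  unfold expSum
  fun_prop

theorem convexOn_expSum (L : ι → E →L[ℝ] ℝ) {c : ι → ℝ} (hc : ∀ i, 0 ≤ c i) :
    ConvexOn ℝ Set.univ (expSum L c) := by
  have h : ∀ i, ConvexOn ℝ Set.univ fun x => c i * Real.exp (L i x) := fun i =>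
    (convexOn_exp.comp_linearMap (L i).toLinearMap).smul (hc i)
  refine ⟨convex_univ, fun x _ y _ a b ha hb hab => ?_⟩
  simp only [expSum, Finset.smul_sum, ← Finset.sum_add_distrib]
  exact Finset.sum_le_sum fun i _ => (h i).2 trivial trivial ha hb hab

theorem PositivelySpans.minimizer_unique {L : ι → E →L[ℝ] ℝ} {c : ι → ℝ}
    (h : PositivelySpans L c) {x y : E} (hx : ∀ z, expSum L c x ≤ expSum L c z)
    (hy : ∀ z, expSum L c y ≤ expSum L c z) : x = y := by
  by_contra hne
  obtain ⟨i, hi, hLi⟩ : ∃ i, c i ≠ 0 ∧ L i x ≠ L i y := by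
    by_contra! hcon
    refine hne (sub_eq_zero.1 (h.2.1 _ fun i hi => ?_))
    rw [map_sub, hcon i hi, sub_self]
  have hmid : expSum L c ((1 / 2 : ℝ) • x + (1 / 2 : ℝ) • y) <
      ∑ i, c i * ((1 / 2 : ℝ) * Real.exp (L i x) + (1 / 2 : ℝ) * Real.exp (L i y)) := by
    refine Finset.sum_lt_sum (fun j _ => mul_le_mul_of_nonneg_left ?_ (h.1 j)) ⟨i, Finset.mem_univ i,
      mul_lt_mul_of_pos_left ?_ (lt_of_le_of_ne (h.1 i) (Ne.symm hi))⟩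
    · simpa using convexOn_exp.2 (Set.mem_univ (L j x)) (Set.mem_univ (L j y))
        (by norm_num : (0 : ℝ) ≤ 1 / 2) (by norm_num : (0 : ℝ) ≤ 1 / 2) (by norm_num)
    · simpa using strictConvexOn_exp.2 (Set.mem_univ (L i x)) (Set.mem_univ (L i y)) hLi
        (by norm_num : (0 : ℝ) < 1 / 2) (by norm_num : (0 : ℝ) < 1 / 2) (by norm_num)
  have hsum : ∑ i, c i * ((1 / 2 : ℝ) * Real.exp (L i x) + (1 / 2 : ℝ) * Real.exp (L i y)) =
      1 / 2 * expSum L c x + 1 / 2 * expSum L c y := by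
    simp only [expSum, Finset.mul_sum, ← Finset.sum_add_distrib]
    exact Finset.sum_congr rfl fun i _ => by ring
  linarith [hx ((1 / 2 : ℝ) • x + (1 / 2 : ℝ) • y), hy x, hx y]

/-- On a sublevel set every frequency in the support is bounded above, hence also below, by the
vanishing positive combination; as the frequencies separate points, the sublevel set is bounded. -/
theorem PositivelySpans.exists_minimizer [FiniteDimensional ℝ E] {L : ι → E →L[ℝ] ℝ} {c : ι → ℝ}
    (h : PositivelySpans L c) : ∃ x, ∀ y, expSum L c x ≤ expSum L c y := by
  classical
  obtain ⟨hc, hsep, μ, hμ, hμc, hμL⟩ := h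
  let Λ : E →ₗ[ℝ] (ι → ℝ) := LinearMap.pi fun i => if c i = 0 then 0 else (L i).toLinearMap
  have hΛ : ∀ x i, Λ x i = if c i = 0 then 0 else L i x := by
    intro x i
    by_cases hi : c i = 0 <;> simp [Λ, hi]
  have hker : LinearMap.ker Λ = ⊥ := by
    rw [LinearMap.ker_eq_bot']
    intro x hx
    refine hsep x fun i hi => ?_
    have := congrFun hx i
    simpa [hΛ, hi] using this
  obtain ⟨K, hK, hanti⟩ := Λ.exists_antilipschitzWith hker
  set R := expSum L c 0
  have hR : 0 ≤ R := Finset.sum_nonneg fun i _ => mul_nonneg (hc i) (Real.exp_pos _).le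
  -- a common upper bound for the frequencies in the support, on the sublevel set of `R`
  set b : ℝ := ∑ i, |Real.log (R / c i)|
  have hb : 0 ≤ b := Finset.sum_nonneg fun i _ => abs_nonneg _
  have hup : ∀ x, expSum L c x ≤ R → ∀ i, c i ≠ 0 → L i x ≤ b := by
    intro x hx i hi
    have hci : 0 < c i := lt_of_le_of_ne (hc i) (Ne.symm hi)
    have h1 : c i * Real.exp (L i x) ≤ R :=
      (Finset.single_le_sum (f := fun i => c i * Real.exp (L i x))
        (fun j _ => mul_nonneg (hc j) (Real.exp_pos _).le) (Finset.mem_univ i)).trans hx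
    have h2 : Real.exp (L i x) ≤ R / c i := by
      rw [le_div_iff₀ hci]; linarith
    have h3 : L i x ≤ Real.log (R / c i) :=
      (Real.le_log_iff_exp_le ((Real.exp_pos _).trans_le h2)).2 h2
    exact (h3.trans (le_abs_self _)).trans (Finset.single_le_sum
      (f := fun i => |Real.log (R / c i)|) (fun j _ => abs_nonneg _) (Finset.mem_univ i))
  set B : ℝ := b + ∑ i, (∑ j, μ j * b) / μ i
  have hμb : 0 ≤ ∑ j, μ j * b := Finset.sum_nonneg fun j _ => mul_nonneg (hμ j) hb
  have hquot : ∀ i, 0 ≤ (∑ j, μ j * b) / μ i := fun i => div_nonneg hμb (hμ i)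
  have hB : 0 ≤ B := add_nonneg hb (Finset.sum_nonneg fun i _ => hquot i)
  have habs : ∀ x, expSum L c x ≤ R → ‖Λ x‖ ≤ B := by
    intro x hx
    refine (pi_norm_le_iff_of_nonneg hB).2 fun i => ?_
    rw [hΛ]
    by_cases hi : c i = 0
    · simpa [hi] using hB
    · rw [if_neg hi, Real.norm_eq_abs, abs_le]
      have hμi : 0 < μ i := lt_of_le_of_ne (hμ i) fun h0 => hi ((hμc i).1 h0.symm)
      have hqi := Finset.single_le_sum (f := fun i => (∑ j, μ j * b) / μ i)
        (fun j _ => hquot j) (Finset.mem_univ i)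
      constructor
      · have h1 : ∑ j, μ j * (b - L j x) = ∑ j, μ j * b := by
          simp only [mul_sub, Finset.sum_sub_distrib, hμL x, sub_zero]
        have h2 : μ i * (b - L i x) ≤ ∑ j, μ j * b := by
          rw [← h1]
          refine Finset.single_le_sum (f := fun j => μ j * (b - L j x)) (fun j _ => ?_)
            (Finset.mem_univ i)
          by_cases hj : c j = 0
          · simp [(hμc j).2 hj]
          · exact mul_nonneg (hμ j) (sub_nonneg.2 (hup x hx j hj))
        have h3 : b - L i x ≤ (∑ j, μ j * b) / μ i := by
          rw [le_div_iff₀ hμi]; linarith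
        simp only [B]
        linarith
      · have := hup x hx i hi
        have h0 := Finset.sum_nonneg fun i (_ : i ∈ Finset.univ) => hquot i
        simp only [B]
        linarith
  have hcont : Continuous (expSum L c) :=
    (continuous_expSum L).comp (continuous_const.prodMk continuous_id)
  refine hcont.exists_forall_le_of_isBounded 0
    (isBounded_iff_forall_norm_le.2 ⟨K * B, fun x hx => ?_⟩)
  calc ‖x‖ ≤ K * ‖Λ x‖ := by simpa using hanti.le_mul_norm_sub x 0
    _ ≤ K * B := mul_le_mul_of_nonneg_left (habs x hx) K.2

/-- A strictly minimal value at the centre of a small sphere persists under perturbation of the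
coefficients, and convexity then confines the perturbed minimizer to the ball. -/
theorem exists_continuousOn_minimizer [FiniteDimensional ℝ E] (L : ι → E →L[ℝ] ℝ) :
    ∃ x : (ι → ℝ) → E, ContinuousOn x {c | PositivelySpans L c} ∧
      ∀ c, PositivelySpans L c → ∀ y, expSum L c (x c) ≤ expSum L c y := by
  classical
  choose! x hx using fun c (h : PositivelySpans L c) => h.exists_minimizer
  refine ⟨x, fun c₀ hc₀ => ?_, hx⟩
  rw [ContinuousWithinAt, Metric.tendsto_nhds]
  intro ε hε
  have hev : ∀ᶠ c in 𝓝 c₀, ∀ y ∈ Metric.sphere (x c₀) ε, expSum L c (x c₀) < expSum L c y := by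
    refine (isCompact_sphere _ _).eventually_forall_of_forall_eventually fun y hy => ?_
    have hlt : expSum L c₀ (x c₀) < expSum L c₀ y := by
      refine lt_of_le_of_ne (hx c₀ hc₀ y) fun heq => ?_
      have : x c₀ = y := hc₀.minimizer_unique (hx c₀ hc₀) fun z => heq ▸ hx c₀ hc₀ z
      rw [← this, Metric.mem_sphere, dist_self] at hy
      exact hε.ne hy
    have h1 : Continuous fun p : (ι → ℝ) × E => expSum L p.1 (x c₀) :=
      (continuous_expSum L).comp (continuous_fst.prodMk continuous_const)
    exact h1.continuousAt.eventually_lt (continuous_expSum L).continuousAt hlt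
  filter_upwards [nhdsWithin_le_nhds hev, self_mem_nhdsWithin] with c hcε hc
  by_contra! hfar
  have hpos : 0 < dist (x c) (x c₀) := hε.trans_le hfar
  set s := ε / dist (x c) (x c₀)
  have hs0 : 0 ≤ s := by positivity
  have hs1 : s ≤ 1 := (div_le_one hpos).2 hfar
  have hy : AffineMap.lineMap (x c₀) (x c) s ∈ Metric.sphere (x c₀) ε := by
    rw [Metric.mem_sphere, dist_lineMap_left, Real.norm_of_nonneg hs0, dist_comm (x c₀)]
    exact div_mul_cancel₀ _ hpos.ne'
  have hseg : AffineMap.lineMap (x c₀) (x c) s ∈ segment ℝ (x c₀) (x c) := by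
    rw [segment_eq_image_lineMap]
    exact ⟨s, ⟨hs0, hs1⟩, rfl⟩
  have h1 := (convexOn_expSum L hc.1).le_max_of_mem_segment trivial trivial hseg
  rw [max_eq_left (hx c hc _)] at h1
  exact absurd h1 (not_le.2 (hcε _ hy))

theorem sum_exp_mul_eq_zero_of_minimizer {L : ι → E →L[ℝ] ℝ} {c : ι → ℝ} {x : E}
    (hx : ∀ y, expSum L c x ≤ expSum L c y) (v : E) :
    ∑ i, c i * Real.exp (L i x) * L i v = 0 := by
  have hd : HasDerivAt (fun t : ℝ => expSum L c (x + t • v))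
      (∑ i, c i * (Real.exp (L i (x + (0 : ℝ) • v)) * (L i v))) 0 := by
    unfold expSum
    refine HasDerivAt.fun_sum fun i _ => HasDerivAt.const_mul _ (HasDerivAt.exp ?_)
    have : HasDerivAt (fun t : ℝ => L i x + t * L i v) (1 * L i v) 0 :=
      ((hasDerivAt_id (0 : ℝ)).mul_const (L i v)).const_add (L i x)
    simpa using this
  have hmin : IsLocalMin (fun t : ℝ => expSum L c (x + t • v)) 0 :=
    Filter.Eventually.of_forall fun t => by simpa using hx (x + t • v)
  have := hmin.hasDerivAt_eq_zero hd
  simpa [mul_assoc] using this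

/-- A critical point is a minimizer, by the inequality `1 + t ≤ exp t`. -/
theorem minimizer_zero_of_sum_mul_eq_zero {L : ι → E →L[ℝ] ℝ} {c : ι → ℝ} (hc : ∀ i, 0 ≤ c i)
    (h : ∀ x, ∑ i, c i * L i x = 0) (y : E) : expSum L c 0 ≤ expSum L c y := by
  have h1 : expSum L c 0 = ∑ i, c i * (L i y + 1) := by
    simp [expSum, mul_add, Finset.sum_add_distrib, h y]
  rw [h1]
  exact Finset.sum_le_sum fun i _ => mul_le_mul_of_nonneg_left (Real.add_one_le_exp _) (hc i)

end ExpSum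

/-! ### Cauchy-Binet over tuples of columns -/

section CauchyBinet

variable {m n : Type*} [Fintype m] [DecidableEq m]

theorem det_mul_eq_sum_prod_mul_det [Fintype n] {R : Type*} [CommRing R] (A : Matrix m n R)
    (B : Matrix n m R) :
    (A * B).det = ∑ σ : m → n, (∏ i, B (σ i) i) * (A.submatrix id σ).det := by
  have h1 : (A * B).det = detRowAlternating (fun i => ∑ k : n, B k i • fun j => A j k) := by
    rw [← det_transpose]
    refine congrArg (fun M : m → m → R => detRowAlternating M) ?_
    ext i j
    simp [Matrix.mul_apply, mul_comm]
  rw [h1]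
  have h2 := (detRowAlternating (n := m) (R := R)).toMultilinearMap.map_sum
    (fun (i : m) (k : n) => B k i • fun j => A j k)
  refine h2.trans (Finset.sum_congr rfl fun σ _ => ?_)
  have h3 := (detRowAlternating (n := m) (R := R)).toMultilinearMap.map_smul_univ
    (fun i => B (σ i) i) (fun i j => A j (σ i))
  refine h3.trans ?_
  rw [smul_eq_mul, ← det_transpose (A.submatrix id σ)]
  rfl

/-- Cauchy-Binet, summed over all tuples of columns instead of over subsets: every subset is counted
once for each of its orderings. -/
theorem factorial_mul_det_mul [Fintype n] {R : Type*} [CommRing R] (A : Matrix m n R)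
    (B : Matrix n m R) :
    ((Fintype.card m).factorial : R) * (A * B).det =
      ∑ σ : m → n, (A.submatrix id σ).det * (B.submatrix σ id).det := by
  have h1 : ∀ π : Equiv.Perm m, (A * B).det =
      ∑ σ : m → n, ((Equiv.Perm.sign π : ℤ) : R) * (∏ i, B (σ (π i)) i) *
        (A.submatrix id σ).det := by
    intro π
    rw [det_mul_eq_sum_prod_mul_det, ← (Equiv.arrowCongr π.symm (Equiv.refl n)).sum_comp]
    refine Finset.sum_congr rfl fun σ _ => ?_
    have h2 : (A.submatrix id (σ ∘ π)).det =
        ((Equiv.Perm.sign π : ℤ) : R) * (A.submatrix id σ).det := by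
      rw [← det_permute' π (A.submatrix id σ)]
      rfl
    change (∏ i, B (σ (π i)) i) * (A.submatrix id (σ ∘ π)).det = _
    rw [h2]
    ring
  calc ((Fintype.card m).factorial : R) * (A * B).det
      = ∑ π : Equiv.Perm m, (A * B).det := by
        rw [Finset.sum_const, Finset.card_univ, Fintype.card_perm, nsmul_eq_mul]
    _ = ∑ π : Equiv.Perm m, ∑ σ : m → n, ((Equiv.Perm.sign π : ℤ) : R) *
          (∏ i, B (σ (π i)) i) * (A.submatrix id σ).det :=
        Finset.sum_congr rfl fun π _ => h1 π
    _ = _ := by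
        rw [Finset.sum_comm]
        refine Finset.sum_congr rfl fun σ _ => ?_
        rw [← Finset.sum_mul, mul_comm, det_apply' (B.submatrix σ id)]
        rfl

/-- The squared modulus of the maximal minor of `G` on the tuple of columns `σ`. -/
noncomputable def minorWeight (G : Matrix m n ℂ) (σ : m → n) : ℝ :=
  ‖(G.submatrix id σ).det‖ ^ 2

theorem minorWeight_nonneg (G : Matrix m n ℂ) (σ : m → n) : 0 ≤ minorWeight G σ := sq_nonneg _

theorem minorWeight_eq_zero {G : Matrix m n ℂ} {σ : m → n} :
    minorWeight G σ = 0 ↔ (G.submatrix id σ).det = 0 := by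
  simp [minorWeight]

theorem minorWeight_of_not_injective (G : Matrix m n ℂ) {σ : m → n}
    (hσ : ¬ Function.Injective σ) : minorWeight G σ = 0 := by
  rw [minorWeight_eq_zero]
  simp only [Function.Injective, not_forall] at hσ
  obtain ⟨i, j, hij, hne⟩ := hσ
  exact det_zero_of_column_eq hne fun k => by simp [hij]

theorem continuous_minorWeight : Continuous (minorWeight : Matrix m n ℂ → (m → n) → ℝ) := by
  refine continuous_pi fun σ => ?_
  unfold minorWeight
  exact ((continuous_id.matrix_submatrix id σ).matrix_det).norm.pow 2

theorem sum_minorWeight [Fintype n] (G : Matrix m n ℂ) :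
    ((∑ σ : m → n, minorWeight G σ : ℝ) : ℂ) = (Fintype.card m).factorial * (G * Gᴴ).det := by
  rw [factorial_mul_det_mul, Complex.ofReal_sum]
  refine Finset.sum_congr rfl fun σ _ => ?_
  rw [← conjTranspose_submatrix, det_conjTranspose, minorWeight, Complex.ofReal_pow,
    ← Complex.mul_conj']
  rfl

/-- Removing the column `j` from `G` lowers the determinant of `G * Gᴴ` by the factor
`1 - gⱼᴴ (G Gᴴ)⁻¹ gⱼ`, and by Cauchy-Binet the lost part is the sum of the minors through `j`. -/
theorem sum_card_mul_minorWeight [Fintype n] [DecidableEq n] (G : Matrix m n ℂ)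
    (hG : (G * Gᴴ).det ≠ 0) (j : n) :
    ((∑ σ : m → n, (Finset.univ.filter fun k => σ k = j).card * minorWeight G σ : ℝ) : ℂ) =
      (∑ σ : m → n, minorWeight G σ : ℝ) * (Gᴴ * (G * Gᴴ)⁻¹ * G) j j := by
  set S := G * Gᴴ with hS
  let G' : Matrix m n ℂ := Matrix.of fun i k => if k = j then 0 else G i k
  have hG'e : ∀ i k, G' i k = if k = j then 0 else G i k := fun i k => rfl
  have hterm : ∀ σ : m → n, ((Finset.univ.filter fun k => σ k = j).card * minorWeight G σ : ℝ) =
      minorWeight G σ - minorWeight G' σ := by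
    intro σ
    by_cases hσ : Function.Injective σ
    · by_cases hj : ∃ k, σ k = j
      · obtain ⟨k, hk⟩ := hj
        have h1 : (Finset.univ.filter fun k => σ k = j) = {k} := by
          ext l
          simp only [Finset.mem_filter, Finset.mem_univ, true_and, Finset.mem_singleton]
          exact ⟨fun h => hσ (h.trans hk.symm), fun h => h ▸ hk⟩
        have h2 : minorWeight G' σ = 0 := by
          rw [minorWeight_eq_zero]
          exact det_eq_zero_of_column_eq_zero k fun i => by simp [hG'e, hk]
        rw [h1, h2]; simp
      · push Not at hj
        have h1 : (Finset.univ.filter fun k => σ k = j) = ∅ := by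
          ext l; simp [hj l]
        have h2 : G'.submatrix id σ = G.submatrix id σ := by
          ext i k; simp [hG'e, hj k]
        rw [h1, minorWeight, minorWeight, h2]; simp
    · simp [minorWeight_of_not_injective _ hσ]
  have hunit : IsUnit S.det := isUnit_iff_ne_zero.2 hG
  have hS' : G' * G'ᴴ = S * (1 - S⁻¹ * (replicateCol Unit (fun i => G i j)) *
      (replicateRow Unit (fun i => star (G i j)))) := by
    rw [Matrix.mul_sub, Matrix.mul_one, Matrix.mul_assoc S⁻¹, ← Matrix.mul_assoc S S⁻¹,
      Matrix.mul_nonsing_inv _ hunit, Matrix.one_mul]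
    ext i k
    simp only [Matrix.sub_apply, hS, Matrix.mul_apply, conjTranspose_apply, hG'e,
      replicateCol_apply, replicateRow_apply, Finset.univ_unique, Finset.sum_singleton]
    rw [← Finset.add_sum_erase _ _ (Finset.mem_univ j),
      ← Finset.add_sum_erase (a := j) (f := fun x => G i x * star (G k x)) _ (Finset.mem_univ j)]
    simp only [if_true, zero_mul, zero_add, add_sub_cancel_left]
    refine Finset.sum_congr rfl fun x hx => ?_
    simp [Finset.ne_of_mem_erase hx]
  have hdet : (G' * G'ᴴ).det = S.det * (1 - (Gᴴ * S⁻¹ * G) j j) := by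
    rw [hS', det_mul, det_one_sub_mul_comm, det_unique (n := Unit), Matrix.sub_apply,
      Matrix.one_apply_eq, ← Matrix.mul_assoc]
    rfl
  have hsum := sum_minorWeight G'
  rw [hdet] at hsum
  rw [Finset.sum_congr rfl fun σ _ => hterm σ, Finset.sum_sub_distrib, Complex.ofReal_sub, hsum,
    sum_minorWeight]
  ring

end CauchyBinet

/-! ### Normalizing a balanced frame -/

section Normalize

open scoped MatrixOrder ComplexOrder

theorem mul_conjTranspose_nonneg {m n : Type*} [Fintype m] [Fintype n] (G : Matrix m n ℂ) :
    0 ≤ G * Gᴴ :=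
  nonneg_iff_posSemidef.2 (posSemidef_self_mul_conjTranspose G)

theorem card_div_card_ne_zero {m n : Type*} [Fintype m] [Fintype n] [Nonempty m] [Nonempty n] :
    ((Fintype.card n / Fintype.card m : ℝ) : ℂ) ≠ 0 := by
  rw [Complex.ofReal_ne_zero]
  have := Fintype.card_ne_zero (α := n)
  have := Fintype.card_ne_zero (α := m)
  positivity

variable {m n : Type*} [Fintype m] [DecidableEq m] [Fintype n]

/-- The matrices whose columns form a finite unit norm tight frame. Comparing traces, the frame
constant can only be the number of vectors divided by the dimension. -/
def funtfMatrices (m n : Type*) [Fintype m] [DecidableEq m] [Fintype n] : Set (Matrix m n ℂ) :=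
  {G | G * Gᴴ = ((Fintype.card n / Fintype.card m : ℝ) : ℂ) • (1 : Matrix m m ℂ) ∧
    ∀ j, (Gᴴ * G) j j = 1}

/-- The columns of `G` span, and all of them occur equally often in a tuple of columns chosen with
probability proportional to its squared minor. -/
def IsBalanced [DecidableEq n] (G : Matrix m n ℂ) : Prop :=
  (G * Gᴴ).det ≠ 0 ∧ ∀ j,
    ∑ σ : m → n, (Finset.univ.filter fun k => σ k = j).card * minorWeight G σ =
      (Fintype.card m / Fintype.card n : ℝ) * ∑ σ : m → n, minorWeight G σ

/-- The multiple of `(G Gᴴ)^(-1/2) G` whose frame operator is that of a finite unit norm tight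
frame. -/
noncomputable def normalizeFrame (G : Matrix m n ℂ) : Matrix m n ℂ :=
  (√(Fintype.card n / Fintype.card m : ℝ) : ℂ) • ((CFC.sqrt (G * Gᴴ))⁻¹ * G)

open scoped Matrix.Norms.L2Operator in
theorem continuousOn_sqrt_matrix :
    ContinuousOn (CFC.sqrt : Matrix m m ℂ → Matrix m m ℂ) {S | 0 ≤ S} :=
  CFC.continuousOn_sqrt

theorem continuousOn_normalizeFrame :
    ContinuousOn (normalizeFrame : Matrix m n ℂ → Matrix m n ℂ) {G | (G * Gᴴ).det ≠ 0} := by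
  have h1 : Continuous fun G : Matrix m n ℂ => G * Gᴴ :=
    continuous_id.matrix_mul continuous_id.matrix_conjTranspose
  have h2 : Continuous fun G : Matrix m n ℂ => CFC.sqrt (G * Gᴴ) :=
    continuousOn_sqrt_matrix.comp_continuous h1 mul_conjTranspose_nonneg
  have h3 : ∀ G : Matrix m n ℂ, (G * Gᴴ).det ≠ 0 → (CFC.sqrt (G * Gᴴ)).det ≠ 0 := by
    intro G hG h0
    rw [← CFC.sqrt_mul_sqrt_self (G * Gᴴ) (mul_conjTranspose_nonneg G), det_mul, h0] at hG
    simp at hG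
  have h4 : ContinuousOn (fun G : Matrix m n ℂ => (CFC.sqrt (G * Gᴴ))⁻¹)
      {G | (G * Gᴴ).det ≠ 0} := by
    simp only [Matrix.inv_def, Ring.inverse_eq_inv']
    exact (h2.matrix_det.continuousOn.inv₀ fun G hG => h3 G hG).smul
      h2.matrix_adjugate.continuousOn
  rw [continuousOn_iff_continuous_domRestrict] at h4 ⊢
  exact (h4.matrix_mul continuous_subtype_val).const_smul
    (√(Fintype.card n / Fintype.card m : ℝ) : ℂ)

theorem normalizeFrame_mul_conjTranspose {G : Matrix m n ℂ} (hG : (G * Gᴴ).det ≠ 0) :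
    normalizeFrame G * (normalizeFrame G)ᴴ =
      ((Fintype.card n / Fintype.card m : ℝ) : ℂ) • (1 : Matrix m m ℂ) ∧
    (normalizeFrame G)ᴴ * normalizeFrame G =
      ((Fintype.card n / Fintype.card m : ℝ) : ℂ) • (Gᴴ * (G * Gᴴ)⁻¹ * G) := by
  have hR : CFC.sqrt (G * Gᴴ) * CFC.sqrt (G * Gᴴ) = G * Gᴴ :=
    CFC.sqrt_mul_sqrt_self (G * Gᴴ) (mul_conjTranspose_nonneg G)
  have hRh : (CFC.sqrt (G * Gᴴ))ᴴ = CFC.sqrt (G * Gᴴ) :=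
    (nonneg_iff_posSemidef.1 (CFC.sqrt_nonneg (G * Gᴴ))).1
  have hRu : IsUnit (CFC.sqrt (G * Gᴴ)).det := by
    refine isUnit_iff_ne_zero.2 fun h0 => hG ?_
    rw [← hR, det_mul, h0, zero_mul]
  have hr : (√(Fintype.card n / Fintype.card m : ℝ) : ℂ) *
      (√(Fintype.card n / Fintype.card m : ℝ) : ℂ) =
      ((Fintype.card n / Fintype.card m : ℝ) : ℂ) := by
    rw [← Complex.ofReal_mul, Real.mul_self_sqrt (by positivity)]
  unfold normalizeFrame
  generalize CFC.sqrt (G * Gᴴ) = R at hR hRh hRu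
  have hinv : (G * Gᴴ)⁻¹ = R⁻¹ * R⁻¹ := by rw [← hR, Matrix.mul_inv_rev]
  constructor
  · rw [conjTranspose_smul, conjTranspose_mul, conjTranspose_nonsing_inv, hRh, Matrix.smul_mul,
      Matrix.mul_smul, smul_smul, Complex.star_def, Complex.conj_ofReal, hr, Matrix.mul_assoc,
      ← Matrix.mul_assoc G, ← hR, Matrix.mul_assoc R, Matrix.mul_nonsing_inv _ hRu,
      Matrix.mul_one, Matrix.nonsing_inv_mul _ hRu]
  · rw [conjTranspose_smul, conjTranspose_mul, conjTranspose_nonsing_inv, hRh, Matrix.smul_mul,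
      Matrix.mul_smul, smul_smul, Complex.star_def, Complex.conj_ofReal, hr, hinv]
    simp only [Matrix.mul_assoc]

theorem det_ne_zero_of_mem_funtfMatrices [Nonempty m] [Nonempty n] {G : Matrix m n ℂ}
    (hG : G ∈ funtfMatrices m n) : (G * Gᴴ).det ≠ 0 := by
  rw [hG.1, det_smul, det_one, mul_one]
  exact pow_ne_zero _ card_div_card_ne_zero

theorem normalizeFrame_of_mem [Nonempty m] [Nonempty n] {G : Matrix m n ℂ}
    (hG : G ∈ funtfMatrices m n) : normalizeFrame G = G := by
  have hr : (√(Fintype.card n / Fintype.card m : ℝ) : ℂ) *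
      (√(Fintype.card n / Fintype.card m : ℝ) : ℂ) =
      ((Fintype.card n / Fintype.card m : ℝ) : ℂ) := by
    rw [← Complex.ofReal_mul, Real.mul_self_sqrt (by positivity)]
  have hr0 : (√(Fintype.card n / Fintype.card m : ℝ) : ℂ) ≠ 0 := by
    intro h0
    rw [h0, zero_mul] at hr
    exact card_div_card_ne_zero hr.symm
  have hsq : CFC.sqrt (G * Gᴴ) =
      (√(Fintype.card n / Fintype.card m : ℝ) : ℂ) • (1 : Matrix m m ℂ) := by
    refine CFC.sqrt_unique ?_ ?_
    · rw [Matrix.smul_mul, Matrix.one_mul, smul_smul, hr, hG.1]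
    · refine nonneg_iff_posSemidef.2 (PosSemidef.one.smul ?_)
      rw [Complex.zero_le_real]
      exact Real.sqrt_nonneg _
  have hinv : ((√(Fintype.card n / Fintype.card m : ℝ) : ℂ) • (1 : Matrix m m ℂ))⁻¹ =
      (√(Fintype.card n / Fintype.card m : ℝ) : ℂ)⁻¹ • (1 : Matrix m m ℂ) :=
    inv_eq_right_inv (by
      rw [Matrix.smul_mul, Matrix.one_mul, smul_smul, mul_inv_cancel₀ hr0, one_smul])
  rw [normalizeFrame, hsq, hinv, Matrix.smul_mul, Matrix.one_mul, smul_smul, mul_inv_cancel₀ hr0,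
    one_smul]

variable [DecidableEq n]

theorem IsBalanced.normalizeFrame_mem [Nonempty m] [Nonempty n] {G : Matrix m n ℂ}
    (hG : IsBalanced G) : normalizeFrame G ∈ funtfMatrices m n := by
  obtain ⟨h1, h2⟩ := normalizeFrame_mul_conjTranspose hG.1
  refine ⟨h1, fun j => ?_⟩
  have hW : ((∑ σ : m → n, minorWeight G σ : ℝ) : ℂ) ≠ 0 := by
    rw [sum_minorWeight]
    exact mul_ne_zero (Nat.cast_ne_zero.2 (Nat.factorial_ne_zero _)) hG.1
  have h3 := sum_card_mul_minorWeight G hG.1 j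
  rw [hG.2 j, Complex.ofReal_mul, mul_comm] at h3
  rw [h2, Matrix.smul_apply, ← mul_left_cancel₀ hW h3, smul_eq_mul, ← Complex.ofReal_mul]
  have hm : (Fintype.card m : ℝ) ≠ 0 := Nat.cast_ne_zero.2 Fintype.card_ne_zero
  have hn : (Fintype.card n : ℝ) ≠ 0 := Nat.cast_ne_zero.2 Fintype.card_ne_zero
  rw [div_mul_div_comm, mul_comm (Fintype.card n : ℝ), div_self (mul_ne_zero hm hn),
    Complex.ofReal_one]

theorem isBalanced_of_mem [Nonempty m] [Nonempty n] {G : Matrix m n ℂ}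
    (hG : G ∈ funtfMatrices m n) : IsBalanced G := by
  have hdet := det_ne_zero_of_mem_funtfMatrices hG
  refine ⟨hdet, fun j => ?_⟩
  have h1 := sum_card_mul_minorWeight G hdet j
  have hinv : (G * Gᴴ)⁻¹ = ((Fintype.card m / Fintype.card n : ℝ) : ℂ) • (1 : Matrix m m ℂ) := by
    refine inv_eq_right_inv ?_
    have hm : (Fintype.card m : ℝ) ≠ 0 := Nat.cast_ne_zero.2 Fintype.card_ne_zero
    have hn : (Fintype.card n : ℝ) ≠ 0 := Nat.cast_ne_zero.2 Fintype.card_ne_zero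
    rw [hG.1, Matrix.smul_mul, Matrix.one_mul, smul_smul, ← Complex.ofReal_mul, div_mul_div_comm,
      mul_comm (Fintype.card n : ℝ), div_self (mul_ne_zero hm hn), Complex.ofReal_one, one_smul]
  rw [hinv, Matrix.mul_smul, Matrix.mul_one, Matrix.smul_mul, Matrix.smul_apply, hG.2 j,
    smul_eq_mul, mul_one, ← Complex.ofReal_mul] at h1
  rw [Complex.ofReal_injective h1, mul_comm]

/-- If there are as many vectors as dimensions, a tuple with nonzero minor is a permutation, so that
it contains every column exactly once. -/
theorem isBalanced_of_card_eq [Nonempty m] (h : Fintype.card m = Fintype.card n)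
    {G : Matrix m n ℂ} (hG : (G * Gᴴ).det ≠ 0) : IsBalanced G := by
  refine ⟨hG, fun j => ?_⟩
  have hm : (Fintype.card m : ℝ) ≠ 0 := Nat.cast_ne_zero.2 Fintype.card_ne_zero
  rw [← h, div_self hm, one_mul]
  refine Finset.sum_congr rfl fun σ _ => ?_
  by_cases hσ : Function.Injective σ
  · obtain ⟨k, hk⟩ := ((Fintype.bijective_iff_injective_and_card σ).2 ⟨hσ, h⟩).2 j
    have h1 : (Finset.univ.filter fun k => σ k = j) = {k} := by
      ext l
      simp only [Finset.mem_filter, Finset.mem_univ, true_and, Finset.mem_singleton]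
      exact ⟨fun h => hσ (h.trans hk.symm), fun h => h ▸ hk⟩
    rw [h1]; simp
  · simp [minorWeight_of_not_injective _ hσ]

end Normalize

/-! ### Scaling a stable frame to a balanced one -/

section Scaling

/-- Multiply the `j`-th column of `G` by `exp (x j / 2)`. -/
noncomputable def scaleColumns {m n : Type*} (G : Matrix m n ℂ) (x : n → ℝ) : Matrix m n ℂ :=
  Matrix.of fun i j => G i j * (Real.exp (x j / 2) : ℂ)

theorem continuous_scaleColumns {m n : Type*} :
    Continuous fun p : Matrix m n ℂ × (n → ℝ) => scaleColumns p.1 p.2 := by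
  refine continuous_matrix fun i j => ?_
  refine (continuous_fst.matrix_elem i j).mul (Complex.continuous_ofReal.comp ?_)
  fun_prop

theorem scaleColumns_zero {m n : Type*} (G : Matrix m n ℂ) : scaleColumns G 0 = G := by
  ext i j
  simp [scaleColumns]

/-- The frequencies `x ↦ ∑ k, x (σ k)` of the minors, corrected by a multiple of `∑ j, x j` so that
they vanish on constants, together with the frequencies `± ∑ j, x j`, which fix the additive
constant left free by the former. -/
noncomputable def minorFrequency (m n : Type*) [Fintype m] [Fintype n] :
    (m → n) ⊕ Bool → (n → ℝ) →L[ℝ] ℝ :=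
  Sum.elim
    (fun σ => ∑ k, ContinuousLinearMap.proj (σ k) -
      (Fintype.card m / Fintype.card n : ℝ) • ∑ j, ContinuousLinearMap.proj j)
    (fun b => (if b then 1 else -1 : ℝ) • ∑ j, ContinuousLinearMap.proj j)

theorem minorFrequency_inl {m n : Type*} [Fintype m] [Fintype n] (σ : m → n)
    (x : n → ℝ) :
    minorFrequency m n (Sum.inl σ) x =
      ∑ k, x (σ k) - (Fintype.card m / Fintype.card n : ℝ) * ∑ j, x j := by
  simp [minorFrequency]

theorem minorFrequency_inr {m n : Type*} [Fintype m] [Fintype n] (b : Bool)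
    (x : n → ℝ) :
    minorFrequency m n (Sum.inr b) x = (if b then 1 else -1 : ℝ) * ∑ j, x j := by
  cases b <;> simp [minorFrequency]

/-- Two columns are linked if a chain of columns, each not orthogonal to the next, leads from one to
the other. -/
def ColumnsLinked {m n : Type*} [Fintype m] (G : Matrix m n ℂ) : n → n → Prop :=
  Relation.ReflTransGen fun a b => (Gᴴ * G) a b ≠ 0

/-- Any two columns of `G` are linked. Equivalently, the columns cannot be split into two nonempty
families that are orthogonal to each other. -/
def IsOrthoIndecomposable {m n : Type*} [Fintype m] (G : Matrix m n ℂ) : Prop :=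
  ∀ i j, ColumnsLinked G i j

variable {m n : Type*} [Fintype m] [DecidableEq m]

theorem minorWeight_scaleColumns (G : Matrix m n ℂ) (x : n → ℝ) (σ : m → n) :
    minorWeight (scaleColumns G x) σ = minorWeight G σ * Real.exp (∑ k, x (σ k)) := by
  have h1 : (scaleColumns G x).submatrix id σ =
      G.submatrix id σ * diagonal fun k => (Real.exp (x (σ k) / 2) : ℂ) := by
    ext i k
    simp [scaleColumns]
  rw [minorWeight, h1, det_mul, det_diagonal, ← Complex.ofReal_prod, ← Real.exp_sum, norm_mul,
    mul_pow, Complex.norm_real, Real.norm_of_nonneg (Real.exp_pos _).le, ← Real.exp_nat_mul,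
    ← Finset.sum_div]
  congr 2
  push_cast
  ring

/-- The squared minors of `G`, as coefficients for the frequencies `minorFrequency`. -/
noncomputable def minorCoeff (G : Matrix m n ℂ) : (m → n) ⊕ Bool → ℝ :=
  Sum.elim (minorWeight G) 1

theorem continuous_minorCoeff : Continuous (minorCoeff : Matrix m n ℂ → (m → n) ⊕ Bool → ℝ) := by
  refine continuous_pi fun i => ?_
  cases i with
  | inl σ => exact (continuous_apply σ).comp continuous_minorWeight
  | inr b => exact continuous_const

variable [Fintype n]

theorem det_mul_conjTranspose_ne_zero_iff {G : Matrix m n ℂ} :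
    (G * Gᴴ).det ≠ 0 ↔ ∃ σ : m → n, (G.submatrix id σ).det ≠ 0 := by
  have h1 := sum_minorWeight G
  have h2 : ((Fintype.card m).factorial : ℂ) ≠ 0 := Nat.cast_ne_zero.2 (Nat.factorial_ne_zero _)
  rw [← not_iff_not, not_not, ← mul_eq_zero_iff_left h2, ← h1,
    Complex.ofReal_eq_zero, Finset.sum_eq_zero_iff_of_nonneg fun σ _ => minorWeight_nonneg G σ]
  simp [minorWeight_eq_zero]

/-- The columns of `G` span, and the exponential sum of its minors is strictly convex and coercive,
so that its columns can be rescaled to a balanced frame, uniquely up to a common factor. -/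
def IsStable (G : Matrix m n ℂ) : Prop :=
  (G * Gᴴ).det ≠ 0 ∧ PositivelySpans (minorFrequency m n) (minorCoeff G)

variable [DecidableEq n]

theorem sum_card_filter_mul (w : (m → n) → ℝ) (x : n → ℝ) :
    ∑ σ, w σ * ∑ k, x (σ k) =
      ∑ j, x j * ∑ σ : m → n, (Finset.univ.filter fun k => σ k = j).card * w σ := by
  have h1 : ∀ σ : m → n, ∑ k, x (σ k) =
      ∑ j, ((Finset.univ.filter fun k => σ k = j).card : ℝ) * x j := by
    intro σ
    rw [← Finset.sum_fiberwise Finset.univ σ (fun k => x (σ k))]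
    refine Finset.sum_congr rfl fun j _ => ?_
    rw [Finset.sum_congr rfl fun k hk => by rw [(Finset.mem_filter.1 hk).2], Finset.sum_const,
      nsmul_eq_mul]
  simp only [h1, Finset.mul_sum]
  rw [Finset.sum_comm]
  exact Finset.sum_congr rfl fun j _ => Finset.sum_congr rfl fun σ _ => by ring

theorem sum_mul_minorFrequency_eq_zero {w : (m → n) → ℝ}
    (hw : ∀ j, ∑ σ : m → n, (Finset.univ.filter fun k => σ k = j).card * w σ =
      (Fintype.card m / Fintype.card n : ℝ) * ∑ σ, w σ) (x : n → ℝ) :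
    ∑ i, Sum.elim w 1 i * minorFrequency m n i x = 0 := by
  have h1 : ∑ σ, w σ * minorFrequency m n (Sum.inl σ) x = 0 := by
    simp only [minorFrequency_inl, mul_sub, Finset.sum_sub_distrib, sum_card_filter_mul, hw]
    rw [← Finset.sum_mul, ← Finset.sum_mul]
    ring
  rw [Fintype.sum_sum_type]
  simp [h1, minorFrequency_inr]

theorem IsStable.isBalanced_scaleColumns [Nonempty n] {G : Matrix m n ℂ} (hG : IsStable G)
    {x : n → ℝ}
    (hx : ∀ y, expSum (minorFrequency m n) (minorCoeff G) x ≤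
      expSum (minorFrequency m n) (minorCoeff G) y) :
    IsBalanced (scaleColumns G x) := by
  have hn : (Fintype.card n : ℝ) ≠ 0 := Nat.cast_ne_zero.2 Fintype.card_ne_zero
  have hcrit := sum_exp_mul_eq_zero_of_minimizer hx
  simp only [Fintype.sum_sum_type, minorFrequency_inl, minorFrequency_inr, Fintype.sum_bool,
    minorCoeff, Sum.elim_inl, Sum.elim_inr, Pi.one_apply, one_mul, if_true,
    Bool.false_eq_true, if_false, neg_mul] at hcrit
  -- differentiating along the constants shows that `x` has sum zero
  have hs : ∑ j, x j = 0 := by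
    have h1 := hcrit 1
    simp only [Pi.one_apply, Finset.sum_const, Finset.card_univ, nsmul_eq_mul, mul_one,
      div_mul_cancel₀ _ hn, sub_self, mul_zero, zero_add] at h1
    have h2 : Real.exp (∑ j, x j) = Real.exp (-∑ j, x j) :=
      mul_right_cancel₀ hn (by linarith)
    linarith [Real.exp_injective h2]
  obtain ⟨σ, hσ⟩ := det_mul_conjTranspose_ne_zero_iff.1 hG.1
  refine ⟨det_mul_conjTranspose_ne_zero_iff.2 ⟨σ, ?_⟩, fun j => ?_⟩
  · rw [Ne, ← minorWeight_eq_zero, minorWeight_scaleColumns, mul_eq_zero, not_or,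
      minorWeight_eq_zero]
    exact ⟨hσ, (Real.exp_pos _).ne'⟩
  · have h1 := hcrit (Pi.single j 1)
    have h2 : ∀ σ : m → n, ∑ k, (Pi.single j 1 : n → ℝ) (σ k) =
        ((Finset.univ.filter fun k => σ k = j).card : ℝ) := by
      intro σ
      rw [Finset.card_filter]
      push_cast
      exact Finset.sum_congr rfl fun k _ => Pi.single_apply j 1 (σ k)
    simp only [hs, mul_zero, sub_zero, neg_zero, Real.exp_zero, h2, Finset.sum_pi_single',
      Finset.mem_univ, if_true, mul_one, mul_sub, Finset.sum_sub_distrib, one_mul,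
      ← minorWeight_scaleColumns] at h1
    rw [← Finset.sum_mul] at h1
    rw [Finset.sum_congr rfl fun σ _ => mul_comm _ _]
    linarith

/-- Stable frames are mapped continuously to finite unit norm tight frames by rescaling to a balanced
frame and then normalizing; a frame that is already tight with unit norms stays fixed. -/
theorem exists_retraction_of_isStable [Nonempty m] [Nonempty n] :
    ∃ r : Matrix m n ℂ → Matrix m n ℂ, ContinuousOn r {G | IsStable G} ∧
      (∀ G, IsStable G → r G ∈ funtfMatrices m n) ∧
      ∀ G, IsStable G → G ∈ funtfMatrices m n → r G = G := by
  obtain ⟨x, hxc, hx⟩ := exists_continuousOn_minimizer (minorFrequency m n)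
  have hbal : ∀ G : Matrix m n ℂ, IsStable G → IsBalanced (scaleColumns G (x (minorCoeff G))) :=
    fun G hG => hG.isBalanced_scaleColumns (hx _ hG.2)
  refine ⟨fun G => normalizeFrame (scaleColumns G (x (minorCoeff G))), ?_,
    fun G hG => (hbal G hG).normalizeFrame_mem, fun G hG hGf => ?_⟩
  · have h1 : ContinuousOn (fun G : Matrix m n ℂ => x (minorCoeff G)) {G | IsStable G} :=
      hxc.comp continuous_minorCoeff.continuousOn fun G hG => hG.2
    exact continuousOn_normalizeFrame.comp
      (continuous_scaleColumns.comp_continuousOn (continuousOn_id.prodMk h1))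
      fun G hG => (hbal G hG).1
  · have h0 : x (minorCoeff G) = 0 :=
      hG.2.minimizer_unique (hx _ hG.2) (minimizer_zero_of_sum_mul_eq_zero hG.2.1
        (sum_mul_minorFrequency_eq_zero (isBalanced_of_mem hGf).2))
    simp only [h0, scaleColumns_zero]
    exact normalizeFrame_of_mem hGf

/-- If all bases among the columns have the same total weight, then by exchange each column `g k` is
an eigenvector, with eigenvalue `x k`, of the map `D` scaling the vectors `g (σ i)` of one basis by
`x (σ i)`. For a tight frame `D` is a multiple of `∑ x k • g k (g k)ᴴ`, hence self-adjoint, and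
eigenvectors for different eigenvalues are orthogonal. -/
theorem eq_of_gram_ne_zero_of_minor_sum_eq [Nonempty m] [Nonempty n] {G : Matrix m n ℂ}
    (hG : G ∈ funtfMatrices m n) {x : n → ℝ} {c : ℝ}
    (hx : ∀ σ : m → n, (G.submatrix id σ).det ≠ 0 → ∑ k, x (σ k) = c) {i j : n}
    (hij : (Gᴴ * G) i j ≠ 0) : x i = x j := by
  obtain ⟨σ, hσ⟩ := det_mul_conjTranspose_ne_zero_iff.1 (det_ne_zero_of_mem_funtfMatrices hG)
  set B := G.submatrix id σ
  have hB : IsUnit B.det := isUnit_iff_ne_zero.2 hσ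
  set X : Matrix n n ℂ := diagonal fun j => (x j : ℂ)
  set Y : Matrix m m ℂ := diagonal fun k => (x (σ k) : ℂ)
  have hY : Y * (B⁻¹ * G) = B⁻¹ * G * X := by
    ext a k
    rw [diagonal_mul, mul_diagonal, mul_comm]
    by_cases h0 : (B⁻¹ * G) a k = 0
    · rw [h0, zero_mul, zero_mul]
    · -- Cramer's rule: the minor with the column `σ a` exchanged for `k` is nonzero
      have h1 : (B⁻¹ * G) a k = B.det⁻¹ * (G.submatrix id (Function.update σ a k)).det := by
        have h2 : G.submatrix id (Function.update σ a k) = B.updateCol a fun i => G i k := by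
          ext i l
          by_cases hl : l = a
          · subst hl; simp
          · simp [B, hl]
        rw [h2, ← cramer_apply, cramer_eq_adjugate_mulVec, inv_def, Ring.inverse_eq_inv',
          Matrix.smul_mul, Matrix.smul_apply, smul_eq_mul]
        rfl
      have h3 : (G.submatrix id (Function.update σ a k)).det ≠ 0 := by
        intro h
        rw [h1, h, mul_zero] at h0
        exact h0 rfl
      have h4 := (hx _ h3).trans (hx σ hσ).symm
      rw [← Finset.add_sum_erase _ _ (Finset.mem_univ a),
        ← Finset.add_sum_erase (a := a) (f := fun k => x (σ k)) _ (Finset.mem_univ a),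
        Finset.sum_congr rfl fun l hl => by
          rw [Function.update_of_ne (Finset.ne_of_mem_erase hl)],
        Function.update_self] at h4
      rw [add_right_cancel h4]
  have hD : B * Y * B⁻¹ * G = G * X := by
    rw [Matrix.mul_assoc, Matrix.mul_assoc, hY, ← Matrix.mul_assoc, ← Matrix.mul_assoc,
      Matrix.mul_nonsing_inv _ hB, Matrix.one_mul]
  have hXh : Xᴴ = X := by
    simp [X, diagonal_conjTranspose, Pi.star_def]
  have hDh : (B * Y * B⁻¹)ᴴ = B * Y * B⁻¹ := by
    have h1 : ((Fintype.card n / Fintype.card m : ℝ) : ℂ) • (B * Y * B⁻¹) = G * X * Gᴴ := by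
      rw [← hD, Matrix.mul_assoc _ G, hG.1, Matrix.mul_smul, Matrix.mul_one]
    have h2 := congrArg conjTranspose h1
    rw [conjTranspose_mul, conjTranspose_mul, conjTranspose_conjTranspose, hXh, ← Matrix.mul_assoc,
      ← h1, conjTranspose_smul, Complex.star_def, Complex.conj_ofReal] at h2
    exact smul_right_injective _ card_div_card_ne_zero h2
  have h1 : Gᴴ * G * X = X * (Gᴴ * G) := by
    have h2 : (G * X)ᴴ = Gᴴ * (B * Y * B⁻¹) := by rw [← hD, conjTranspose_mul, hDh]
    rw [conjTranspose_mul, hXh] at h2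
    rw [Matrix.mul_assoc, ← hD, ← Matrix.mul_assoc, ← h2, Matrix.mul_assoc]
  have h2 := congrFun (congrFun h1 i) j
  rw [mul_diagonal, diagonal_mul, mul_comm] at h2
  exact Complex.ofReal_injective (mul_right_cancel₀ hij h2).symm

theorem IsOrthoIndecomposable.isStable [Nonempty m] [Nonempty n] {G : Matrix m n ℂ}
    (hG : IsOrthoIndecomposable G) (hGf : G ∈ funtfMatrices m n) : IsStable G := by
  refine ⟨det_ne_zero_of_mem_funtfMatrices hGf, ?_, fun x hx => ?_, minorCoeff G, ?_,
    fun i => Iff.rfl, fun x => sum_mul_minorFrequency_eq_zero (isBalanced_of_mem hGf).2 x⟩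
  · rintro (σ | b)
    exacts [minorWeight_nonneg G σ, zero_le_one]
  · have hs : ∑ j, x j = 0 := by
      simpa [minorFrequency_inr] using hx (Sum.inr true) (by simp [minorCoeff])
    have hc : ∀ σ : m → n, (G.submatrix id σ).det ≠ 0 → ∑ k, x (σ k) = 0 := by
      intro σ hσ
      have := hx (Sum.inl σ) (by simpa [minorCoeff, minorWeight_eq_zero] using hσ)
      simpa [minorFrequency_inl, hs] using this
    have hconst : ∀ i j, x i = x j := by
      intro i j
      have hij := hG i j
      induction hij with
      | refl => rfl
      | tail _ h ih => exact ih.trans (eq_of_gram_ne_zero_of_minor_sum_eq hGf hc h)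
    funext i
    have h1 : ∑ j, x j = Fintype.card n * x i := by
      rw [Finset.sum_congr rfl fun j _ => hconst j i, Finset.sum_const, Finset.card_univ,
        nsmul_eq_mul]
    have hn : (Fintype.card n : ℝ) ≠ 0 := Nat.cast_ne_zero.2 Fintype.card_ne_zero
    exact (mul_eq_zero.1 (h1.symm.trans hs)).resolve_left hn
  · rintro (σ | b)
    exacts [minorWeight_nonneg G σ, zero_le_one]

end Scaling

/-! ### Full spark frames -/

section FullSpark

/-- Every choice of `card m` distinct columns of `G` is a basis. -/
def IsFullSpark {m n : Type*} [Fintype m] [DecidableEq m] (G : Matrix m n ℂ) : Prop :=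
  ∀ σ : m → n, Function.Injective σ → (G.submatrix id σ).det ≠ 0

theorem exists_isFullSpark (d N : ℕ) : ∃ g : Matrix (Fin d) (Fin N) ℂ, IsFullSpark g := by
  refine ⟨Matrix.of fun i j => (j : ℂ) ^ (i : ℕ), fun σ hσ => ?_⟩
  have h1 : (Matrix.of fun (i : Fin d) (j : Fin N) => (j : ℂ) ^ (i : ℕ)).submatrix id σ =
      (vandermonde fun k => ((σ k : ℕ) : ℂ))ᵀ := by
    ext i k
    simp [vandermonde_apply]
  rw [h1, det_transpose, det_vandermonde_ne_zero_iff]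
  exact Nat.cast_injective.comp (Fin.val_injective.comp hσ)

theorem finite_setOf_det_eq_zero {m : Type*} [Fintype m] [DecidableEq m] (A B : Matrix m m ℂ)
    (hB : B.det ≠ 0) : {z : ℂ | ((1 - z) • A + z • B).det = 0}.Finite := by
  let P : Polynomial ℂ :=
    ((1 - Polynomial.X : Polynomial ℂ) • A.map Polynomial.C +
      (Polynomial.X : Polynomial ℂ) • B.map Polynomial.C).det
  have hP : ∀ z, P.eval z = ((1 - z) • A + z • B).det := by
    intro z
    rw [← Polynomial.coe_evalRingHom, RingHom.map_det]
    congr 1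
    ext i j
    simp
    ring
  have hP0 : P ≠ 0 := by
    intro h
    have := hP 1
    rw [h] at this
    simp at this
    exact hB this.symm
  refine (Polynomial.finite_setOfPred_isRoot hP0).subset fun z hz => ?_
  exact (hP z).trans hz

/-- The exceptional parameters are the roots of finitely many nonzero polynomials, and a countable
set does not disconnect the complex plane. -/
theorem isPathConnected_setOf_isFullSpark {m n : Type*} [Fintype m] [DecidableEq m] [Fintype n]
    (G : Matrix m n ℂ) {g : Matrix m n ℂ} (hg : IsFullSpark g) :
    IsPathConnected {z : ℂ | z = 0 ∨ IsFullSpark ((1 - z) • G + z • g)} := by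
  have h1 : (⋃ σ : {σ : m → n // Function.Injective σ},
      {z : ℂ | ((1 - z) • G.submatrix id σ.1 + z • g.submatrix id σ.1).det = 0}).Finite :=
    Set.finite_iUnion fun σ => finite_setOf_det_eq_zero _ _ (hg σ.1 σ.2)
  have h2 : {z : ℂ | z = 0 ∨ IsFullSpark ((1 - z) • G + z • g)} =
      ((⋃ σ : {σ : m → n // Function.Injective σ},
      {z : ℂ | ((1 - z) • G.submatrix id σ.1 + z • g.submatrix id σ.1).det = 0}) \ {0})ᶜ := by
    ext z
    simp only [IsFullSpark, Set.mem_ofPred_eq, Set.mem_compl_iff, Set.mem_sdiff, Set.mem_iUnion,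
      Set.mem_singleton_iff, not_and, not_not, Subtype.exists, exists_prop]
    constructor
    · rintro (h | h) ⟨σ, hσ, h0⟩
      exacts [h, absurd h0 (h σ hσ)]
    · intro h
      by_cases hz : z = 0
      · exact Or.inl hz
      · exact Or.inr fun σ hσ h0 => hz (h ⟨σ, hσ, h0⟩)
  rw [h2]
  refine (h1.subset Set.sdiff_subset).countable.isPathConnected_compl_of_one_lt_rank ?_
  rw [Complex.rank_real_complex]
  exact Cardinal.one_lt_two

variable {m n : Type*} [Fintype m] [DecidableEq m] [Fintype n]

theorem IsFullSpark.det_ne_zero (hmn : Fintype.card m ≤ Fintype.card n) {G : Matrix m n ℂ}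
    (hG : IsFullSpark G) : (G * Gᴴ).det ≠ 0 := by
  obtain ⟨e⟩ := Function.Embedding.nonempty_of_card_le hmn
  exact det_mul_conjTranspose_ne_zero_iff.2 ⟨e, hG e e.injective⟩

/-- A frame joined to a fixed full spark frame by a path of frames on which the retraction `r` is
defined is joined to the image of that full spark frame by a path of finite unit norm tight
frames. -/
theorem joinedIn_of_retraction {S : Set (Matrix m n ℂ)} {r : Matrix m n ℂ → Matrix m n ℂ}
    (hr : ContinuousOn r S) (hmem : ∀ G ∈ S, r G ∈ funtfMatrices m n)
    (hS : ∀ G, IsFullSpark G → G ∈ S) {g : Matrix m n ℂ} (hg : IsFullSpark g)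
    {G : Matrix m n ℂ} (hG : G ∈ S) (hrG : r G = G) :
    JoinedIn (funtfMatrices m n) G (r g) := by
  set T := {z : ℂ | z = 0 ∨ IsFullSpark ((1 - z) • G + z • g)} with hT
  have hTS : Set.MapsTo (fun z : ℂ => (1 - z) • G + z • g) T S := by
    rintro z (rfl | hz)
    · simpa using hG
    · exact hS _ hz
  have hc : Continuous fun z : ℂ => (1 - z) • G + z • g := by fun_prop
  have h1 := (isPathConnected_setOf_isFullSpark G hg).image' (hr.comp hc.continuousOn hTS)
  have h2 := h1.joinedIn _ (Set.mem_image_of_mem _ (show (0 : ℂ) ∈ T from Or.inl rfl)) _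
    (Set.mem_image_of_mem _ (show (1 : ℂ) ∈ T from Or.inr (by simpa using hg)))
  simp only [Function.comp_apply, sub_zero, one_smul, zero_smul, add_zero, sub_self, zero_add,
    hrG] at h2
  refine h2.mono ?_
  rintro _ ⟨z, hz, rfl⟩
  exact hmem _ (hTS hz)

variable [DecidableEq n]

theorem sum_card_filter_mul_of_perm_invariant [Nonempty n] {w : (m → n) → ℝ}
    (hw : ∀ (π : Equiv.Perm n) (σ : m → n), w (π ∘ σ) = w σ) (j : n) :
    ∑ σ : m → n, (Finset.univ.filter fun k => σ k = j).card * w σ =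
      (Fintype.card m / Fintype.card n : ℝ) * ∑ σ, w σ := by
  have hn : (Fintype.card n : ℝ) ≠ 0 := Nat.cast_ne_zero.2 Fintype.card_ne_zero
  have h1 : ∀ i, ∑ σ : m → n, (Finset.univ.filter fun k => σ k = i).card * w σ =
      ∑ σ : m → n, (Finset.univ.filter fun k => σ k = j).card * w σ := by
    intro i
    rw [← (Equiv.arrowCongr (Equiv.refl m) (Equiv.swap i j)).sum_comp]
    refine Finset.sum_congr rfl fun σ _ => ?_
    have h2 : (Equiv.arrowCongr (Equiv.refl m) (Equiv.swap i j)) σ = Equiv.swap i j ∘ σ := rfl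
    rw [h2, hw]
    congr 3
    ext k
    simp [Equiv.swap_apply_eq_iff]
  have h3 := sum_card_filter_mul w (1 : n → ℝ)
  simp only [Pi.one_apply, one_mul, h1, Finset.sum_const, Finset.card_univ, nsmul_eq_mul,
    mul_one] at h3
  rw [← Finset.sum_mul] at h3
  field_simp
  linarith

theorem IsFullSpark.isStable [Nonempty m] (hmn : Fintype.card m < Fintype.card n)
    {G : Matrix m n ℂ} (hG : IsFullSpark G) : IsStable G := by
  classical
  have hn0 : Nonempty n := Fintype.card_pos_iff.1 (by omega)
  have hw : ∀ σ : m → n, minorWeight G σ = 0 ↔ ¬ Function.Injective σ := fun σ =>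
    ⟨fun h hσ => hG σ hσ (minorWeight_eq_zero.1 h), minorWeight_of_not_injective G⟩
  refine ⟨hG.det_ne_zero hmn.le, ?_, fun x hx => ?_,
    Sum.elim (fun σ => if Function.Injective σ then 1 else 0) 1, ?_, ?_, fun x =>
    sum_mul_minorFrequency_eq_zero (sum_card_filter_mul_of_perm_invariant fun π σ => ?_) x⟩
  · rintro (σ | b)
    exacts [minorWeight_nonneg G σ, zero_le_one]
  · have hs : ∑ j, x j = 0 := by
      simpa [minorFrequency_inr] using hx (Sum.inr true) (by simp [minorCoeff])
    have hc : ∀ σ : m → n, Function.Injective σ → ∑ k, x (σ k) = 0 := by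
      intro σ hσ
      have := hx (Sum.inl σ) (by simpa [minorCoeff, hw] using hσ)
      simpa [minorFrequency_inl, hs] using this
    -- compare a tuple through `i` that avoids `j` with the one in which `j` replaces `i`
    have hconst : ∀ i j, x i = x j := by
      intro i j
      rcases eq_or_ne i j with rfl | hij
      · rfl
      obtain ⟨e⟩ := Function.Embedding.nonempty_of_card_le
        (α := m) (β := {k : n // k ≠ j}) (by simp; omega)
      obtain ⟨k₀⟩ := ‹Nonempty m›
      let σ : m → n := fun k => Equiv.swap (e k₀ : n) i (e k)
      have hσ : Function.Injective σ :=
        (Equiv.injective _).comp (Subtype.val_injective.comp e.injective)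
      have hσi : σ k₀ = i := Equiv.swap_apply_left _ _
      have hσj : ∀ k, σ k ≠ j := by
        intro k hk
        have h1 : (e k : n) = Equiv.swap (e k₀ : n) i j := Equiv.swap_apply_eq_iff.1 hk
        rw [Equiv.swap_apply_of_ne_of_ne (e k₀).2.symm hij.symm] at h1
        exact (e k).2 h1
      have h1 := (hc _ ((Equiv.swap i j).injective.comp hσ)).trans (hc σ hσ).symm
      simp only [Function.comp_apply] at h1
      rw [← Finset.add_sum_erase _ _ (Finset.mem_univ k₀),
        ← Finset.add_sum_erase (a := k₀) (f := fun k => x (σ k)) _ (Finset.mem_univ k₀),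
        Finset.sum_congr rfl fun k hk => by
          rw [Equiv.swap_apply_of_ne_of_ne
            (fun h => Finset.ne_of_mem_erase hk (hσ (h.trans hσi.symm))) (hσj k)],
        hσi, Equiv.swap_apply_left] at h1
      exact (add_right_cancel h1).symm
    funext i
    have h1 : ∑ j, x j = Fintype.card n * x i := by
      rw [Finset.sum_congr rfl fun j _ => hconst j i, Finset.sum_const, Finset.card_univ,
        nsmul_eq_mul]
    have hn : (Fintype.card n : ℝ) ≠ 0 := Nat.cast_ne_zero.2 Fintype.card_ne_zero
    exact (mul_eq_zero.1 (h1.symm.trans hs)).resolve_left hn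
  · rintro (σ | b)
    · simp only [Sum.elim_inl]
      split_ifs
      exacts [zero_le_one, le_rfl]
    · exact zero_le_one
  · rintro (σ | b)
    · simp [minorCoeff, hw]
    · simp [minorCoeff]
  · simp only [EmbeddingLike.comp_injective]

end FullSpark

/-! ### Joining orthogonal pieces by rotations -/

section Rotation

theorem gram_swap {m n : Type*} [Fintype m] (G H : Matrix m n ℂ) (a b : n) :
    (Gᴴ * H) a b = star ((Hᴴ * G) b a) := by
  rw [← conjTranspose_apply, conjTranspose_mul, conjTranspose_conjTranspose]

theorem ColumnsLinked.symm {m n : Type*} [Fintype m] {G : Matrix m n ℂ} {a b : n}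
    (h : ColumnsLinked G a b) : ColumnsLinked G b a := by
  have : Std.Symm fun a b => (Gᴴ * G) a b ≠ 0 :=
    ⟨fun a b hab => by rw [gram_swap]; exact star_ne_zero.2 hab⟩
  exact Relation.ReflTransGen.stdSymm.symm _ _ h

/-- Rotate the columns `p` and `q` of `G` by the angle `t` in the plane they span. -/
noncomputable def rotateColumns {m n : Type*} [DecidableEq n] (G : Matrix m n ℂ) (p q : n) (t : ℝ) :
    Matrix m n ℂ :=
  Matrix.of fun i j =>
    if j = p then (Real.cos t : ℂ) * G i p + (Real.sin t : ℂ) * G i q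
    else if j = q then -(Real.sin t : ℂ) * G i p + (Real.cos t : ℂ) * G i q
    else G i j

theorem continuous_rotateColumns {m n : Type*} [DecidableEq n] (G : Matrix m n ℂ) (p q : n) :
    Continuous (rotateColumns G p q) := by
  refine continuous_matrix fun i j => ?_
  have hc := Complex.continuous_ofReal.comp Real.continuous_cos
  have hs := Complex.continuous_ofReal.comp Real.continuous_sin
  simp only [rotateColumns, Matrix.of_apply]
  split_ifs
  · exact (hc.mul continuous_const).add (hs.mul continuous_const)
  · exact (hs.neg.mul continuous_const).add (hc.mul continuous_const)
  · exact continuous_const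

theorem rotateColumns_zero {m n : Type*} [DecidableEq n] (G : Matrix m n ℂ) (p q : n) :
    rotateColumns G p q 0 = G := by
  ext i j
  simp only [rotateColumns, Matrix.of_apply]
  split_ifs with h1 h2 <;> simp [*]

theorem cos_sq_add_sin_sq_ofReal (t : ℝ) : (Real.cos t : ℂ) ^ 2 + (Real.sin t : ℂ) ^ 2 = 1 := by
  exact_mod_cast Real.cos_sq_add_sin_sq t

theorem rotateColumns_mul_conjTranspose {m n : Type*} [Fintype n] [DecidableEq n]
    (G : Matrix m n ℂ) {p q : n} (hpq : p ≠ q) (t : ℝ) :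
    rotateColumns G p q t * (rotateColumns G p q t)ᴴ = G * Gᴴ := by
  ext i k
  rw [← sub_eq_zero, Matrix.mul_apply, Matrix.mul_apply, ← Finset.sum_sub_distrib,
    Finset.sum_eq_add p q hpq]
  · simp only [rotateColumns, conjTranspose_apply, Matrix.of_apply, if_true, hpq.symm, if_false,
      star_add, star_mul', star_neg, Complex.star_def, Complex.conj_ofReal]
    linear_combination (G i p * (starRingEnd ℂ) (G k p) + G i q * (starRingEnd ℂ) (G k q)) *
      cos_sq_add_sin_sq_ofReal t
  · intro j _ hj
    simp [rotateColumns, hj.1, hj.2]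
  · simp
  · simp

theorem gram_rotateColumns {m n : Type*} [Fintype m] [DecidableEq n] (G H : Matrix m n ℂ)
    {p q : n} (hpq : p ≠ q) (t : ℝ) (b : n) :
    (Hᴴ * rotateColumns G p q t) b p =
        (Real.cos t : ℂ) * (Hᴴ * G) b p + (Real.sin t : ℂ) * (Hᴴ * G) b q ∧
      (Hᴴ * rotateColumns G p q t) b q =
        -(Real.sin t : ℂ) * (Hᴴ * G) b p + (Real.cos t : ℂ) * (Hᴴ * G) b q ∧
      ∀ a, a ≠ p → a ≠ q → (Hᴴ * rotateColumns G p q t) b a = (Hᴴ * G) b a := by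
  refine ⟨?_, ?_, fun a hp hq => ?_⟩
  · simp only [Matrix.mul_apply, rotateColumns, Matrix.of_apply, if_true, Finset.mul_sum,
      ← Finset.sum_add_distrib]
    exact Finset.sum_congr rfl fun i _ => by ring
  · simp only [Matrix.mul_apply, rotateColumns, Matrix.of_apply, if_true, hpq.symm, if_false,
      Finset.mul_sum, ← Finset.sum_add_distrib]
    exact Finset.sum_congr rfl fun i _ => by ring
  · simp [Matrix.mul_apply, rotateColumns, hp, hq]

variable {m n : Type*} [Fintype m] [DecidableEq m] [Fintype n] [DecidableEq n]

theorem rotateColumns_mem {G : Matrix m n ℂ} (hG : G ∈ funtfMatrices m n) {p q : n} (hpq : p ≠ q)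
    (h0 : (Gᴴ * G) p q = 0) (t : ℝ) : rotateColumns G p q t ∈ funtfMatrices m n := by
  refine ⟨by rw [rotateColumns_mul_conjTranspose G hpq, hG.1], fun j => ?_⟩
  have h0' : (Gᴴ * G) q p = 0 := by rw [gram_swap, h0, star_zero]
  have hR := gram_rotateColumns G (rotateColumns G p q t) hpq t
  have hL := gram_rotateColumns G G hpq t
  have hcs := cos_sq_add_sin_sq_ofReal t
  by_cases hp : j = p
  · subst hp
    rw [(hR j).1, gram_swap _ G j j, gram_swap _ G j q, (hL j).1, (hL q).1, hG.2 j, hG.2 q, h0, h0']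
    simp only [star_add, star_mul', star_zero, star_one, Complex.star_def, Complex.conj_ofReal]
    linear_combination hcs
  · by_cases hq : j = q
    · subst hq
      rw [(hR j).2.1, gram_swap _ G j j, gram_swap _ G j p, (hL j).2.1, (hL p).2.1, hG.2 j, hG.2 p,
        h0, h0']
      simp only [star_add, star_mul', star_zero, star_one, star_neg, Complex.star_def,
        Complex.conj_ofReal]
      linear_combination hcs
    · rw [(hR j).2.2 j hp hq, gram_swap, (hL j).2.2 j hp hq, hG.2 j, star_one]

/-- With more vectors than dimensions no column is orthogonal to all others, since the frame
constant exceeds `1`. -/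
theorem exists_gram_ne_zero [Nonempty m] [Nonempty n] (hmn : Fintype.card m < Fintype.card n)
    {G : Matrix m n ℂ} (hG : G ∈ funtfMatrices m n) (p : n) : ∃ b, b ≠ p ∧ (Gᴴ * G) p b ≠ 0 := by
  by_contra! hcon
  have h1 : Gᴴ * G * (Gᴴ * G) = ((Fintype.card n / Fintype.card m : ℝ) : ℂ) • (Gᴴ * G) := by
    rw [Matrix.mul_assoc, ← Matrix.mul_assoc G, hG.1, Matrix.smul_mul, Matrix.one_mul,
      Matrix.mul_smul]
  have h2 := congrFun (congrFun h1 p) p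
  rw [Matrix.mul_apply, Finset.sum_eq_single p (fun b _ hb => by rw [hcon b hb, zero_mul])
    (fun h => absurd (Finset.mem_univ p) h), Matrix.smul_apply, hG.2 p, mul_one, smul_eq_mul,
    mul_one] at h2
  have h3 : (1 : ℝ) = Fintype.card n / Fintype.card m := by exact_mod_cast h2
  have hm : (0 : ℝ) < Fintype.card m := Nat.cast_pos.2 Fintype.card_pos
  rw [eq_div_iff hm.ne', one_mul] at h3
  exact hmn.ne (Nat.cast_injective h3)

/-- Rotating two unlinked columns keeps all links, since each rotated column inherits the neighbours
of both, and for the same reason links the two columns. -/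
theorem columnsLinked_rotateColumns [Nonempty m] [Nonempty n]
    (hmn : Fintype.card m < Fintype.card n) {G : Matrix m n ℂ} (hG : G ∈ funtfMatrices m n)
    {p q : n} (hpq : ¬ ColumnsLinked G p q) {t : ℝ} (hc : Real.cos t ≠ 0) (hs : Real.sin t ≠ 0) :
    (∀ a b, ColumnsLinked G a b → ColumnsLinked (rotateColumns G p q t) a b) ∧
      ColumnsLinked (rotateColumns G p q t) p q := by
  have hne : p ≠ q := fun h => hpq (h ▸ Relation.ReflTransGen.refl)
  have hc' : (Real.cos t : ℂ) ≠ 0 := Complex.ofReal_ne_zero.2 hc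
  have hs' : (Real.sin t : ℂ) ≠ 0 := Complex.ofReal_ne_zero.2 hs
  have hK : ∀ a b, (Gᴴ * G) a b ≠ 0 → ColumnsLinked G a b := fun a b h =>
    Relation.ReflTransGen.single h
  have h0 : (Gᴴ * G) p q = 0 := by
    by_contra h
    exact hpq (hK _ _ h)
  have h0' : (Gᴴ * G) q p = 0 := by rw [gram_swap, h0, star_zero]
  set G' := rotateColumns G p q t
  have hG' : ∀ a b, (G'ᴴ * G') a b ≠ 0 → ColumnsLinked G' a b := fun a b h =>
    Relation.ReflTransGen.single h
  have hR := gram_rotateColumns G G' hne t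
  have hL := gram_rotateColumns G G hne t
  -- the inner products of a column outside the pair with the two rotated columns
  have hout : ∀ a, a ≠ p → a ≠ q →
      (G'ᴴ * G') a p = (Real.cos t : ℂ) * (Gᴴ * G) a p + (Real.sin t : ℂ) * (Gᴴ * G) a q ∧
      (G'ᴴ * G') a q = -(Real.sin t : ℂ) * (Gᴴ * G) a p + (Real.cos t : ℂ) * (Gᴴ * G) a q := by
    intro a hap haq
    have h1 : ∀ b, (G'ᴴ * G) a b = (Gᴴ * G) a b := by
      intro b
      rw [gram_swap, (hL b).2.2 a hap haq, ← gram_swap]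
    rw [(hR a).1, (hR a).2.1, h1, h1]
    exact ⟨rfl, rfl⟩
  have hedge_p : ∀ a, a ≠ p → a ≠ q → (Gᴴ * G) a p ≠ 0 →
      ColumnsLinked G' a p ∧ ColumnsLinked G' a q := by
    intro a hap haq h
    have hq0 : (Gᴴ * G) a q = 0 := by
      by_contra h'
      exact hpq ((hK _ _ h).symm.trans (hK _ _ h'))
    refine ⟨hG' _ _ ?_, hG' _ _ ?_⟩
    · rw [(hout a hap haq).1, hq0, mul_zero, add_zero]
      exact mul_ne_zero hc' h
    · rw [(hout a hap haq).2, hq0, mul_zero, add_zero]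
      exact mul_ne_zero (neg_ne_zero.2 hs') h
  have hedge_q : ∀ a, a ≠ p → a ≠ q → (Gᴴ * G) a q ≠ 0 → ColumnsLinked G' a q := by
    intro a hap haq h
    have hp0 : (Gᴴ * G) a p = 0 := by
      by_contra h'
      exact hpq ((hK _ _ h').symm.trans (hK _ _ h))
    refine hG' _ _ ?_
    rw [(hout a hap haq).2, hp0, mul_zero, zero_add]
    exact mul_ne_zero hc' h
  have hsymm : ∀ a b, (Gᴴ * G) a b ≠ 0 → (Gᴴ * G) b a ≠ 0 := fun a b h => by
    rw [gram_swap]; exact star_ne_zero.2 h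
  have hedge : ∀ a b, (Gᴴ * G) a b ≠ 0 → ColumnsLinked G' a b := by
    intro a b h
    by_cases hap : a = p
    · subst hap
      by_cases hba : b = a
      · subst hba; exact Relation.ReflTransGen.refl
      by_cases hbq : b = q
      · subst hbq; exact absurd h0 h
      exact (hedge_p b hba hbq (hsymm _ _ h)).1.symm
    by_cases haq : a = q
    · subst haq
      by_cases hba : b = a
      · subst hba; exact Relation.ReflTransGen.refl
      by_cases hbp : b = p
      · subst hbp; exact absurd h0' h
      exact (hedge_q b hbp hba (hsymm _ _ h)).symm
    by_cases hbp : b = p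
    · subst hbp; exact (hedge_p a hap haq h).1
    by_cases hbq : b = q
    · subst hbq; exact hedge_q a hap haq h
    refine hG' _ _ ?_
    rw [(hR a).2.2 b hbp hbq, gram_swap, (hL b).2.2 a hap haq, ← gram_swap]
    exact h
  refine ⟨fun a b hab => ?_, ?_⟩
  · induction hab with
    | refl => exact Relation.ReflTransGen.refl
    | tail _ h ih => exact ih.trans (hedge _ _ h)
  · obtain ⟨b, hbp, hb⟩ := exists_gram_ne_zero hmn hG p
    have hbq : b ≠ q := fun h => hb (h ▸ h0)
    have := hedge_p b hbp hbq (hsymm _ _ hb)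
    exact this.1.symm.trans this.2

/-- Induction on the number of unlinked pairs of columns. -/
theorem exists_joinedIn_isOrthoIndecomposable [Nonempty m] [Nonempty n]
    (hmn : Fintype.card m < Fintype.card n) {G : Matrix m n ℂ} (hG : G ∈ funtfMatrices m n) :
    ∃ G' ∈ funtfMatrices m n, IsOrthoIndecomposable G' ∧ JoinedIn (funtfMatrices m n) G G' := by
  induction hk : {x : n × n | ¬ ColumnsLinked G x.1 x.2}.ncard using Nat.strong_induction_on
    generalizing G with
  | _ k ih =>
    by_cases hconn : IsOrthoIndecomposable G
    · exact ⟨G, hG, hconn, JoinedIn.refl hG⟩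
    · obtain ⟨p, q, hpq⟩ : ∃ p q, ¬ ColumnsLinked G p q := by
        simpa [IsOrthoIndecomposable] using hconn
      have hne : p ≠ q := fun h => hpq (h ▸ Relation.ReflTransGen.refl)
      have h0 : (Gᴴ * G) p q = 0 := by
        by_contra h
        exact hpq (Relation.ReflTransGen.single h)
      have hmem := rotateColumns_mem hG hne h0
      obtain ⟨hmono, hlink⟩ := columnsLinked_rotateColumns hmn hG hpq (t := 1)
        Real.cos_one_pos.ne'
        (Real.sin_pos_of_pos_of_lt_pi one_pos (by linarith [Real.pi_gt_three])).ne'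
      have hjoin : JoinedIn (funtfMatrices m n) G (rotateColumns G p q 1) := by
        refine JoinedIn.ofLine (f := rotateColumns G p q)
          (continuous_rotateColumns G p q).continuousOn (rotateColumns_zero G p q) rfl ?_
        rintro _ ⟨t, _, rfl⟩
        exact hmem t
      have hlt : {x : n × n | ¬ ColumnsLinked (rotateColumns G p q 1) x.1 x.2}.ncard < k := by
        rw [← hk]
        refine Set.ncard_lt_ncard ⟨fun x hx h => hx (hmono _ _ h), fun h => ?_⟩ (Set.toFinite _)
        exact h (show (p, q) ∈ _ from hpq) hlink
      obtain ⟨G', hG', hconn', hj⟩ := ih _ hlt (hmem 1) rfl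
      exact ⟨G', hG', hconn', hjoin.trans hj⟩

end Rotation

/-! ### From matrices to tuples of vectors -/

section Columns

/-- The columns of a matrix, as vectors of a Euclidean space. -/
noncomputable def columnVectors {N d : ℕ} (G : Matrix (Fin d) (Fin N) ℂ) :
    Fin N → EuclideanSpace ℂ (Fin d) :=
  fun j => WithLp.toLp 2 fun i => G i j

theorem continuous_columnVectors {N d : ℕ} :
    Continuous (columnVectors : Matrix (Fin d) (Fin N) ℂ → Fin N → EuclideanSpace ℂ (Fin d)) :=
  continuous_pi fun j => (PiLp.continuous_toLp 2 _).comp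
    (continuous_pi fun i => continuous_id.matrix_elem i j)

variable {N d : ℕ}

theorem gram_self_eq_norm_sq (G : Matrix (Fin d) (Fin N) ℂ) (j : Fin N) :
    (Gᴴ * G) j j = ((‖columnVectors G j‖ ^ 2 : ℝ) : ℂ) := by
  rw [EuclideanSpace.norm_sq_eq, Complex.ofReal_sum, Matrix.mul_apply]
  refine Finset.sum_congr rfl fun i _ => ?_
  rw [Complex.ofReal_pow, ← Complex.conj_mul']
  rfl

theorem sum_norm_inner_sq_eq_dotProduct (G : Matrix (Fin d) (Fin N) ℂ)
    (x : EuclideanSpace ℂ (Fin d)) :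
    ((∑ j, ‖inner ℂ x (columnVectors G j)‖ ^ 2 : ℝ) : ℂ) =
      star (x : Fin d → ℂ) ⬝ᵥ ((G * Gᴴ) *ᵥ (x : Fin d → ℂ)) := by
  have h1 : ∀ j, inner ℂ x (columnVectors G j) = (star (x : Fin d → ℂ) ᵥ* G) j := by
    intro j
    rw [EuclideanSpace.inner_eq_star_dotProduct, dotProduct_comm]
    rfl
  have h2 : Gᴴ *ᵥ (x : Fin d → ℂ) = star (star (x : Fin d → ℂ) ᵥ* G) := by
    rw [star_vecMul, star_star]
  rw [← mulVec_mulVec, dotProduct_mulVec, h2, Complex.ofReal_sum]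
  refine Finset.sum_congr rfl fun j _ => ?_
  rw [h1, Complex.ofReal_pow, ← Complex.mul_conj']
  rfl

theorem norm_sq_eq_dotProduct (x : EuclideanSpace ℂ (Fin d)) :
    ((‖x‖ ^ 2 : ℝ) : ℂ) = star (x : Fin d → ℂ) ⬝ᵥ (x : Fin d → ℂ) := by
  rw [EuclideanSpace.norm_sq_eq, Complex.ofReal_sum]
  refine Finset.sum_congr rfl fun i _ => ?_
  rw [Complex.ofReal_pow, ← Complex.conj_mul']
  rfl

open scoped MatrixOrder ComplexOrder in
/-- A tight frame has a scalar frame operator, since a Hermitian matrix is determined by its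
quadratic form; the scalar is found by comparing traces. -/
theorem mem_funtfMatrices_of_tight (hd : 1 ≤ d) {G : Matrix (Fin d) (Fin N) ℂ}
    (h1 : ∀ j, (Gᴴ * G) j j = 1) {A : ℝ}
    (hA : ∀ x : Fin d → ℂ, star x ⬝ᵥ ((G * Gᴴ) *ᵥ x) = A * (star x ⬝ᵥ x)) :
    G ∈ funtfMatrices (Fin d) (Fin N) := by
  have hherm : (G * Gᴴ - (A : ℂ) • (1 : Matrix (Fin d) (Fin d) ℂ)).IsHermitian := by
    refine (isHermitian_mul_conjTranspose_self G).sub ?_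
    rw [IsHermitian, conjTranspose_smul, conjTranspose_one, Complex.star_def, Complex.conj_ofReal]
  have hq : ∀ x : Fin d → ℂ,
      star x ⬝ᵥ ((G * Gᴴ - (A : ℂ) • (1 : Matrix (Fin d) (Fin d) ℂ)) *ᵥ x) = 0 := by
    intro x
    rw [sub_mulVec, dotProduct_sub, hA, smul_mulVec, one_mulVec, dotProduct_smul, smul_eq_mul,
      sub_self]
  have h2 : G * Gᴴ - (A : ℂ) • (1 : Matrix (Fin d) (Fin d) ℂ) = 0 := by
    refine le_antisymm ?_ ?_
    · rw [Matrix.le_iff, zero_sub]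
      refine PosSemidef.of_dotProduct_mulVec_nonneg hherm.neg fun x => ?_
      rw [neg_mulVec, dotProduct_neg, hq, neg_zero]
    · rw [nonneg_iff_posSemidef]
      exact PosSemidef.of_dotProduct_mulVec_nonneg hherm fun x => (hq x).ge
  rw [sub_eq_zero] at h2
  have h3 : (A : ℂ) * d = N := by
    have h4 := congrArg trace h2
    rw [trace_mul_comm, trace_smul, trace_one, Fintype.card_fin, smul_eq_mul] at h4
    rw [← h4, trace]
    simp [h1]
  have hd0 : (d : ℂ) ≠ 0 := Nat.cast_ne_zero.2 (by omega)
  refine ⟨?_, h1⟩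
  rw [h2, eq_div_of_mul_eq hd0 h3, Fintype.card_fin, Fintype.card_fin]
  push_cast
  rfl

theorem FUNTF_eq_image (hd : 1 ≤ d) (hN : d ≤ N) :
    FUNTF ℂ N d = columnVectors '' funtfMatrices (Fin d) (Fin N) := by
  ext f
  constructor
  · rintro ⟨hnorm, A, -, -, hA⟩
    let G : Matrix (Fin d) (Fin N) ℂ := Matrix.of fun i j => f j i
    have hGf : columnVectors G = f := rfl
    refine ⟨G, mem_funtfMatrices_of_tight hd (A := A) (fun j => ?_) fun x => ?_, hGf⟩
    · rw [gram_self_eq_norm_sq, hGf, hnorm j]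
      simp
    · have h1 := sum_norm_inner_sq_eq_dotProduct G (WithLp.toLp 2 x)
      have h2 := norm_sq_eq_dotProduct (WithLp.toLp 2 x)
      rw [hGf, le_antisymm (hA _).2 (hA _).1, Complex.ofReal_mul, h2] at h1
      exact h1.symm
  · rintro ⟨G, hG, rfl⟩
    have hpos : (0 : ℝ) < N / d :=
      div_pos (Nat.cast_pos.2 (by omega)) (Nat.cast_pos.2 (by omega))
    refine ⟨fun j => ?_, N / d, hpos, hpos, fun x => ?_⟩
    · have h1 := gram_self_eq_norm_sq G j
      rw [hG.2 j, eq_comm, Complex.ofReal_eq_one] at h1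
      exact (pow_eq_one_iff_of_nonneg (norm_nonneg _) two_ne_zero).1 h1
    · have h1 : ∑ j, ‖inner ℂ x (columnVectors G j)‖ ^ 2 = N / d * ‖x‖ ^ 2 := by
        apply Complex.ofReal_injective
        rw [sum_norm_inner_sq_eq_dotProduct, hG.1, smul_mulVec, one_mulVec, dotProduct_smul,
          smul_eq_mul, ← norm_sq_eq_dotProduct, Complex.ofReal_mul, Fintype.card_fin,
          Fintype.card_fin]
      exact ⟨h1.ge, h1.le⟩

end Columns

/-! ### Path-connectedness -/

theorem isPathConnected_funtfMatrices {m n : Type*} [Fintype m] [DecidableEq m] [Fintype n]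
    [DecidableEq n] [Nonempty m] (hmn : Fintype.card m ≤ Fintype.card n) {g : Matrix m n ℂ}
    (hg : IsFullSpark g) : IsPathConnected (funtfMatrices m n) := by
  have hn : Nonempty n := Fintype.card_pos_iff.1 (Fintype.card_pos.trans_le hmn)
  rcases hmn.eq_or_lt with heq | hlt
  · have hmem : ∀ G ∈ {G : Matrix m n ℂ | (G * Gᴴ).det ≠ 0},
        normalizeFrame G ∈ funtfMatrices m n := fun G hG =>
      (isBalanced_of_card_eq heq hG).normalizeFrame_mem
    refine ⟨normalizeFrame g, hmem g (hg.det_ne_zero hmn), fun G hG => ?_⟩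
    exact (joinedIn_of_retraction continuousOn_normalizeFrame hmem
      (fun G hG => hG.det_ne_zero hmn) hg (det_ne_zero_of_mem_funtfMatrices hG)
      (normalizeFrame_of_mem hG)).symm
  · obtain ⟨r, hr, hmem, hfix⟩ := exists_retraction_of_isStable (m := m) (n := n)
    refine ⟨r g, hmem g (hg.isStable hlt), fun G hG => ?_⟩
    obtain ⟨G', hG', hind, hj⟩ := exists_joinedIn_isOrthoIndecomposable hlt hG
    have hst := hind.isStable hG'
    exact (hj.trans (joinedIn_of_retraction hr hmem (fun G hG => hG.isStable hlt) hg hst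
      (hfix G' hst hG'))).symm

theorem theorem1p1 (N d : ℕ) (hd : 1 ≤ d) (hN : d ≤ N) : IsPathConnected (FUNTF ℂ N d) := by
  have : Nonempty (Fin d) := ⟨⟨0, hd⟩⟩
  obtain ⟨g, hg⟩ := exists_isFullSpark d N
  rw [FUNTF_eq_image hd hN]
  exact (isPathConnected_funtfMatrices (by simpa using hN) hg).image continuous_columnVectors
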